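/- Let $\Bbbk$ be a field of characteristic zero, $d\ge 0$, $m\ge 1$, $\mathbf n=(n_1,\dots,n_d)\in\mathbb N^d$, $\mathbf r=(r_1,\dots,r_m)$ with all $r_k\ge 2$, $R=r_1\cdots r_m$; write $[\mathbf n]=[n_1]\times\cdots\times[n_d]$ and $\odot$ for the entrywise (Hadamard) product of tensors in $\Bbbk^{n_1\times\cdots\times n_d}$. Let $\mathcal S^*$ be the group, under $\odot$, of rank-$1$ tensors with all entries nonzero. *Definitions.* A *CPD* of $T$ is a decomposition of $T$ as a sum of rank-$1$ tensors of minimal length $\operatorname{rank}(T)$; $T$ is *$R$-identifiable* if it has rank $R$ and a unique CPD up to reordering. An *$\mathbf r$-HHD* of $T$ is a family of rank-$1$ tensors $(A_{k,l})_{k\in[m],\,l\in[r_k]}$ with $T=\bigodot_{k=1}^m\sum_{l=1}^{r_k}A_{k,l}$. The *essential* HHDs of $T$ are the classes of $\mathbf r$-HHDs of $T$ modulo reordering the terms inside each factor, permuting factors of equal length, and replacing $A_{k,l}$ by $D_k\odot A_{k,l}$ with $D_1,\dots,D_m\in\mathcal S^*$ whose Hadamard product is the all-ones tensor. $T$ is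 *$\mathbf r$-identifiable* if it has exactly one essential HHD. For a bijection $\rho:[R]\to[\mathbf r']$ (where $\mathbf r'$ is any shape with all $r'_k\ge2$ and $\prod_k r'_k=R$) let $\mathcal A^\rho$ be the set of $\mathbf a\in\Bbbk^R$ such that the tensor with entry $a_i$ at position $\rho(i)$ has rank $1$. Then $\rho$ is a *maximal rank-$1$ permutation* of $\mathbf a$ if $\mathbf a\in\mathcal A^\rho$ and $\mathbf a\notin\mathcal A^{\rho'}$ whenever $\rho'$ (of any such shape) satisfies $\mathcal A^{\rho'}\subsetneq\mathcal A^\rho$. It is the *unique* one if every maximal rank-$1$ permutation $\rho'$ of $\mathbf a$ (of any such shape $\mathbf r'$) has the form $\sigma\circ\rho$, where the bijection $\sigma:[\mathbf r]\to[\mathbf r']$ maps rank-$1$ tensors to rank-$1$ tensors. *Algorithm* (input $T$, with a chosen index $\mathbf p\in[\mathbf n]$). 1. Compute a CPD $T=B_1+\cdots+B_R$. 2. Compute a maximal rank-$1$ permutation $\rho:[R]\to[\mathbf r]$ of $\mathbf b_{\mathbf p}=((B_1)_{\mathbf p},\dots,(B_R)_{\mathbf p})$. 3. Form the tensor $H$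 with $H_{\rho(s),:}=B_s$ for $s\in[R]$, and choose a base index $\mathbf i\in[\mathbf r]$ with $H_{\mathbf i,:}\in\mathcal S^*$. 4. For each $\mathbf j\in[\mathbf n]$ compute the interpolatory decomposition of $H_{:,\mathbf j}$ at $\mathbf i$: with $\mathbf i[k\to l]$ denoting $\mathbf i$ with its $k$th entry replaced by $l$, put $(A_{1,l})_{\mathbf j}=H_{\mathbf i[1\to l],\mathbf j}$ and $(A_{k,l})_{\mathbf j}=H_{\mathbf i[k\to l],\mathbf j}/H_{\mathbf i,\mathbf j}$ for $k\ge2$. Return $(A_{k,l})$. **Proposition.** Suppose that $T\in\Bbbk^{n_1\times\cdots\times n_d}$ is $\mathbf r$-identifiable and $R$-identifiable, that some term of its CPD lies in $\mathcal S^*$, and that $\mathbf p\in[\mathbf n]$ is such that the vector $\mathbf b_{\mathbf p}$ of $\mathbf p$-entries of the terms of the CPD has distinct entries and a unique maximal rank-$1$ permutation, which is of shape $\mathbf r$. Then the algorithm recovers the essential HHD of $T$: whatever CPD is returned in step 1, a permutation $\rho$ as in step 2 exists; for every such $\rho$ a base index as in step 3 exists; and for each such choice of $\rho$ and $\mathbf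 i$ the output $(A_{k,l})$ satisfies $H_{\mathbf q,:}=A_{1,q_1}\odot\cdots\odot A_{m,q_m}$ for all $\mathbf q\in[\mathbf r]$, is an $\mathbf r$-HHD of $T$, and represents the unique essential HHD of $T$. -/

import Mathlib

open scoped BigOperators

/-- The multi-indices `[n] = [n_1] × ⋯ × [n_d]`. -/
abbrev MultiIndex {d : ℕ} (n : Fin d → ℕ) : Type := ∀ i, Fin (n i)

/-- Tensors in `K^{n_1 × ⋯ × n_d}`, in coordinates. The pointwise product of this function space
is the Hadamard product, and `1` is the all-ones tensor. -/
abbrev Tensor (K : Type*) {d : ℕ} (n : Fin d → ℕ) : Type _ := MultiIndex n → K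

/-- The tensor product `v_1 ⊗ ⋯ ⊗ v_d` of vectors. -/
def outer {K : Type*} [Field K] {d : ℕ} {n : Fin d → ℕ} (v : ∀ i, Fin (n i) → K) : Tensor K n :=
  fun j => ∏ i, v i (j i)

/-- Tensors of rank exactly one: the nonzero tensors `c • (v_1 ⊗ ⋯ ⊗ v_d)`.
(The scalar `c` only matters for `d = 0`.) -/
def IsRankOne {K : Type*} [Field K] {d : ℕ} {n : Fin d → ℕ} (T : Tensor K n) : Prop :=
  T ≠ 0 ∧ ∃ (c : K) (v : ∀ i, Fin (n i) → K), T = c • outer v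

/-- The group `S^*` of rank-one tensors all of whose entries are nonzero. -/
def IsRankOneUnit {K : Type*} [Field K] {d : ℕ} {n : Fin d → ℕ} (T : Tensor K n) : Prop :=
  (∀ j, T j ≠ 0) ∧ ∃ (c : K) (v : ∀ i, Fin (n i) → K), T = c • outer v

/-- `T = B_1 + ⋯ + B_s` is an (ordered) Hitchcock decomposition of length `s`. -/
def IsHitchcock {K : Type*} [Field K] {d : ℕ} {n : Fin d → ℕ} {s : ℕ}
    (T : Tensor K n) (B : Fin s → Tensor K n) : Prop :=
  (∀ i, IsRankOne (B i)) ∧ T = ∑ i, B i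

/-- The tensor rank. -/
noncomputable def tensorRank {K : Type*} [Field K] {d : ℕ} {n : Fin d → ℕ} (T : Tensor K n) : ℕ :=
  sInf {s : ℕ | ∃ B : Fin s → Tensor K n, IsHitchcock T B}

/-- `B` lists the terms of a CPD of `T`, that is, of a Hitchcock decomposition of minimum length. -/
def IsCPD {K : Type*} [Field K] {d : ℕ} {n : Fin d → ℕ} {s : ℕ}
    (T : Tensor K n) (B : Fin s → Tensor K n) : Prop :=
  tensorRank T = s ∧ IsHitchcock T B

/-- The set of Hitchcock decompositions of `T` of length `s`, up to reordering the terms. -/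
def decompositions {K : Type*} [Field K] {d : ℕ} {n : Fin d → ℕ} (s : ℕ) (T : Tensor K n) :
    Set (Multiset (Tensor K n)) :=
  {M | ∃ B : Fin s → Tensor K n, IsHitchcock T B ∧ M = Finset.univ.val.map B}

/-- `T` has rank `s` and exactly one CPD. -/
def IsIdentifiable {K : Type*} [Field K] {d : ℕ} {n : Fin d → ℕ} (s : ℕ) (T : Tensor K n) : Prop :=
  tensorRank T = s ∧ ∃ M, decompositions s T = {M}

/-- `A` is an ordered `r`-Hadamard–Hitchcock decomposition of `T`: the tensors `A k i` have rank
one and `T` is the Hadamard product over `k` of the sums `∑ i, A k i`. -/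
def IsHHD {K : Type*} [Field K] {d m : ℕ} {n : Fin d → ℕ} {r : Fin m → ℕ}
    (T : Tensor K n) (A : ∀ k, Fin (r k) → Tensor K n) : Prop :=
  (∀ k i, IsRankOne (A k i)) ∧ T = ∏ k, ∑ i, A k i

/-- Two ordered HHDs are essentially the same if they differ by
a permutation `ψ` of Hadamard factors of equal length, permutations `π k` of the terms inside the
factors, and Hadamard multiplication of the factors by elements `D k` of `S^*` whose Hadamard
product is the all-ones tensor. (A bijection `π k` exists precisely if `r k = r (ψ k)`.) -/
def EssentiallyEqual {K : Type*} [Field K] {d m : ℕ} {n : Fin d → ℕ} {r : Fin m → ℕ}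
    (A A' : ∀ k, Fin (r k) → Tensor K n) : Prop :=
  ∃ (ψ : Equiv.Perm (Fin m)) (π : ∀ k, Fin (r k) ≃ Fin (r (ψ k))) (D : Fin m → Tensor K n),
    (∀ k, IsRankOneUnit (D k)) ∧ ∏ k, D k = 1 ∧ ∀ k i, A' k i = D k * A (ψ k) (π k i)

theorem IsRankOneUnit.one {K : Type*} [Field K] {d : ℕ} {n : Fin d → ℕ} :
    IsRankOneUnit (1 : Tensor K n) :=
  ⟨fun _ => one_ne_zero, 1, fun _ _ => 1, by ext j; simp [outer]⟩

theorem IsRankOneUnit.mul {K : Type*} [Field K] {d : ℕ} {n : Fin d → ℕ} {S T : Tensor K n}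
    (hS : IsRankOneUnit S) (hT : IsRankOneUnit T) : IsRankOneUnit (S * T) := by
  obtain ⟨hS0, c, v, rfl⟩ := hS
  obtain ⟨hT0, c', v', rfl⟩ := hT
  refine ⟨fun j => mul_ne_zero (hS0 j) (hT0 j), c * c', fun i x => v i x * v' i x, ?_⟩
  ext j
  simp only [outer, Pi.mul_apply, Pi.smul_apply, smul_eq_mul, Finset.prod_mul_distrib]
  ring

theorem IsRankOneUnit.inv {K : Type*} [Field K] {d : ℕ} {n : Fin d → ℕ} {S : Tensor K n}
    (hS : IsRankOneUnit S) : IsRankOneUnit S⁻¹ := by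
  obtain ⟨hS0, c, v, rfl⟩ := hS
  refine ⟨fun j => inv_ne_zero (hS0 j), c⁻¹, fun i x => (v i x)⁻¹, ?_⟩
  ext j
  simp only [outer, Pi.inv_apply, Pi.smul_apply, smul_eq_mul, Finset.prod_inv_distrib, mul_inv]

theorem EssentiallyEqual.refl {K : Type*} [Field K] {d m : ℕ} {n : Fin d → ℕ} {r : Fin m → ℕ}
    (A : ∀ k, Fin (r k) → Tensor K n) : EssentiallyEqual A A :=
  ⟨Equiv.refl _, fun _ => Equiv.refl _, fun _ => 1, fun _ => IsRankOneUnit.one, by simp,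
    fun k i => (one_mul (A k i)).symm⟩

theorem EssentiallyEqual.symm {K : Type*} [Field K] {d m : ℕ} {n : Fin d → ℕ} {r : Fin m → ℕ}
    {A A' : ∀ k, Fin (r k) → Tensor K n} (h : EssentiallyEqual A A') : EssentiallyEqual A' A := by
  obtain ⟨ψ, π, D, hD, hprod, hA⟩ := h
  have key : ∀ k' k, ψ k' = k → ∃ e : Fin (r k) ≃ Fin (r k'),
      ∀ i, A k i = (D k')⁻¹ * A' k' (e i) := by
    rintro k' k rfl
    refine ⟨(π k').symm, fun i => ?_⟩
    rw [hA]
    ext j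
    have := (hD k').1 j
    simp [this]
  choose e he using fun k => key (ψ.symm k) k (by simp)
  refine ⟨ψ.symm, e, fun k => (D (ψ.symm k))⁻¹, fun k => (hD _).inv, ?_, he⟩
  rw [Equiv.prod_comp ψ.symm (fun k => (D k)⁻¹), Finset.prod_inv_distrib, hprod, inv_one]

theorem EssentiallyEqual.trans {K : Type*} [Field K] {d m : ℕ} {n : Fin d → ℕ} {r : Fin m → ℕ}
    {A A' A'' : ∀ k, Fin (r k) → Tensor K n} (h : EssentiallyEqual A A')
    (h' : EssentiallyEqual A' A'') : EssentiallyEqual A A'' := by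
  obtain ⟨ψ, π, D, hD, hprod, hA⟩ := h
  obtain ⟨ψ', π', D', hD', hprod', hA'⟩ := h'
  refine ⟨ψ'.trans ψ, fun k => (π' k).trans (π (ψ' k)), fun k => D' k * D (ψ' k),
    fun k => (hD' k).mul (hD _), ?_, fun k i => ?_⟩
  · rw [Finset.prod_mul_distrib, Equiv.prod_comp ψ' D, hprod, hprod', one_mul]
  · rw [hA', hA, mul_assoc]; rfl

/-- Essential equality as an equivalence relation on the ordered `r`-HHDs of `T`. -/
def essentialSetoid {K : Type*} [Field K] {d m : ℕ} {n : Fin d → ℕ} (r : Fin m → ℕ)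
    (T : Tensor K n) : Setoid {A : ∀ k, Fin (r k) → Tensor K n // IsHHD T A} where
  r A A' := EssentiallyEqual A.1 A'.1
  iseqv := ⟨fun A => EssentiallyEqual.refl A.1, fun h => h.symm, fun h h' => h.trans h'⟩

/-- The set of essential `r`-HHDs of `T`. -/
def EssentialHHD {K : Type*} [Field K] {d m : ℕ} {n : Fin d → ℕ} (r : Fin m → ℕ)
    (T : Tensor K n) : Type _ := Quotient (essentialSetoid r T)

/-- The essential HHD given by an ordered HHD. -/
def EssentialHHD.mk {K : Type*} [Field K] {d m : ℕ} {n : Fin d → ℕ} {r : Fin m → ℕ}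
    {T : Tensor K n} (A : ∀ k, Fin (r k) → Tensor K n) (h : IsHHD T A) : EssentialHHD r T :=
  Quotient.mk (essentialSetoid r T) ⟨A, h⟩

/-- `T` is `r`-identifiable: it has exactly one essential `r`-HHD. -/
def IsHHDIdentifiable {K : Type*} [Field K] {d m : ℕ} {n : Fin d → ℕ} (r : Fin m → ℕ)
    (T : Tensor K n) : Prop :=
  ∃ E : EssentialHHD r T, ∀ E' : EssentialHHD r T, E' = E

/-- The set `A^ρ` of the vectors `a` that are admissible for the bijection `ρ : [R] → [r]`, which
means that `ρ` is a rank-1 permutation of `a`: the tensor with entry `a i` at position `ρ i` has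
rank one. -/
def admissible (K : Type*) [Field K] {R m : ℕ} {r : Fin m → ℕ} (ρ : Fin R ≃ MultiIndex r) :
    Set (Fin R → K) :=
  {a | IsRankOne (n := r) (fun q => a (ρ.symm q))}

/-- `σ : [r] → [r']` is a rank-1 preserver permutation. -/
def IsRankOnePreserver (K : Type*) [Field K] {m m' : ℕ} {r : Fin m → ℕ} {r' : Fin m' → ℕ}
    (σ : MultiIndex r ≃ MultiIndex r') : Prop :=
  ∀ X : Tensor K r, IsRankOne X → IsRankOne (n := r') (fun q => X (σ.symm q))

/-- `ρ` is a maximal rank-1 permutation of `a`: it is a rank-1 permutation of `a`, and `a` is not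
admissible for any `ρ'`, onto multi-indices of any shape `r'` with entries at least `2`, whose
set of admissible vectors is strictly smaller. -/
def IsMaximalRankOnePerm {K : Type*} [Field K] {R m : ℕ} {r : Fin m → ℕ}
    (ρ : Fin R ≃ MultiIndex r) (a : Fin R → K) : Prop :=
  a ∈ admissible K ρ ∧
    ∀ (m' : ℕ) (r' : Fin m' → ℕ), (∀ k, 2 ≤ r' k) → ∀ ρ' : Fin R ≃ MultiIndex r',
      admissible K ρ' ⊂ admissible K ρ → a ∉ admissible K ρ'

/-- `a` has a maximal rank-1 permutation onto `[r]`, and this is its only maximal rank-1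
permutation, of whatever shape, up to rank-1 preserver permutations. -/
def HasUniqueMaximalRankOnePerm {K : Type*} [Field K] {R m : ℕ} (r : Fin m → ℕ)
    (a : Fin R → K) : Prop :=
  ∃ ρ : Fin R ≃ MultiIndex r, IsMaximalRankOnePerm ρ a ∧
    ∀ (m' : ℕ) (r' : Fin m' → ℕ), (∀ k, 2 ≤ r' k) → ∀ ρ' : Fin R ≃ MultiIndex r',
      IsMaximalRankOnePerm ρ' a → IsRankOnePreserver K (ρ.symm.trans ρ')

/-- The vector `b_p = ((B_1)_p, …, (B_R)_p)`. -/
def entryVector {K : Type*} [Field K] {d R : ℕ} {n : Fin d → ℕ} (B : Fin R → Tensor K n)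
    (p : MultiIndex n) : Fin R → K :=
  fun s => B s p

/-- The Hadamard–Hitchcock tensor of an ordered HHD. -/
def hht {K : Type*} [Field K] {d m : ℕ} {n : Fin d → ℕ} {r : Fin m → ℕ}
    (A : ∀ k, Fin (r k) → Tensor K n) : MultiIndex r → Tensor K n :=
  fun q => ∏ k, A k (q k)

/-- The tensor `H` with `H_{ρ(s),:} = B_s`. -/
def stack {K : Type*} [Field K] {d m R : ℕ} {n : Fin d → ℕ} {r : Fin m → ℕ}
    (ρ : Fin R ≃ MultiIndex r) (B : Fin R → Tensor K n) : MultiIndex r → Tensor K n :=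
  fun q => B (ρ.symm q)

/-- The interpolatory decomposition of a rank-one tensor `X` at an index `i` with `X i ≠ 0`:
the vectors `a_1, …, a_m` with `X = a_1 ⊗ ⋯ ⊗ a_m` and `(a_k)_{i_k} = 1` for all `k` but the first
one, read off from the entries of `X` on the `i`-cross. -/
noncomputable def interpolate {K : Type*} [Field K] {m : ℕ} [NeZero m] {r : Fin m → ℕ}
    (i : MultiIndex r) (X : Tensor K r) : ∀ k, Fin (r k) → K :=
  fun k l => if k = 0 then X (Function.update i k l) else X (Function.update i k l) / X i

/-- `interpolate i` inverts the parametrization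
`(a_1, …, a_m) ↦ a_1 ⊗ ⋯ ⊗ a_m`, `(a_k)_{i_k} = 1` for all `k` but the first. -/
theorem interpolate_outer {K : Type*} [Field K] {m : ℕ} [NeZero m] {r : Fin m → ℕ}
    (i : MultiIndex r) (a : ∀ k, Fin (r k) → K) (h0 : a 0 (i 0) ≠ 0)
    (h1 : ∀ k, k ≠ 0 → a k (i k) = 1) : interpolate i (outer a) = a := by
  have hX : outer a i = a 0 (i 0) := by
    unfold outer
    exact Finset.prod_eq_single 0 (fun k _ hk => h1 k hk) (by simp)
  funext k l
  unfold interpolate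
  split_ifs with hk
  · subst hk
    unfold outer
    rw [Finset.prod_eq_single 0 (fun k _ hk => by simp [Function.update_of_ne hk, h1 k hk])
      (by simp)]
    simp
  · rw [hX, div_eq_iff h0]
    unfold outer
    rw [← Finset.mul_prod_erase _ _ (Finset.mem_univ k)]
    rw [Finset.prod_eq_single_of_mem (0 : Fin m) (by simp [Ne.symm hk])]
    · simp [Function.update_of_ne (Ne.symm hk)]
    · intro b hb hb0
      rw [Function.update_of_ne (Finset.ne_of_mem_erase hb), h1 b hb0]

/-- The steps of the algorithm after the CPD `B` and the rank-1 permutation `ρ` are computed: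
arrange the terms in the tensor `H`, and fill in the entries of the output tensors `A_{k l}`, for
each `j ∈ [n]`, from the interpolatory decomposition of `H_{:,j}` at the base index `i`. -/
noncomputable def decouple {K : Type*} [Field K] {d m R : ℕ} [NeZero m] {n : Fin d → ℕ}
    {r : Fin m → ℕ} (ρ : Fin R ≃ MultiIndex r) (B : Fin R → Tensor K n) (i : MultiIndex r) :
    ∀ k, Fin (r k) → Tensor K n :=
  fun k l j => interpolate i (fun q => stack ρ B q j) k l

/-! ### Elementary tensors, interpolation and rank -/

section RankOne

variable {K : Type*} [Field K]

/-! Expand the factors of an HHD `A` of `T` into the `R` products `hht A q`. They are elementary and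
sum to a tensor of rank `R`, so none vanishes, and `R`-identifiability makes them the CPD terms
arranged by some `ρ₁` (`IsHHD.exists_stack_eq`). At each `j`, the vector of `j`-entries of the CPD
terms is thus an outer product when arranged by `ρ₁`, and it is nonzero because one term lies in
`S^*`: it lies in the admissible set of `ρ₁`.

The algorithm sees only the index `p` and may pick another `ρ`. Uniqueness of the maximal
permutation at `p` forces `ρ` and `ρ₁` to have the same admissible set
(`HasUniqueMaximalRankOnePerm.admissible_eq`), so every slice of `H` is rank one for `ρ` as well.
Interpolation is then exact at each `j` and yields rank-one tensors (`hht_decouple`,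
`isRankOne_decouple`). The output is therefore an HHD, and `r`-identifiability leaves only one class
for it to represent. -/

theorem smul_outer_mul_smul_outer {d : ℕ} {n : Fin d → ℕ} (c c' : K)
    (v v' : ∀ i, Fin (n i) → K) :
    (c • outer v) * (c' • outer v') = (c * c') • outer fun i x => v i x * v' i x := by
  ext j
  simp only [outer, Pi.mul_apply, Pi.smul_apply, smul_eq_mul, Finset.prod_mul_distrib]
  ring

theorem IsRankOneUnit.mul_isRankOne {d : ℕ} {n : Fin d → ℕ} {D X : Tensor K n}
    (hD : IsRankOneUnit D) (hX : IsRankOne X) : IsRankOne (D * X) := by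
  obtain ⟨hD0, c, v, hv⟩ := hD
  obtain ⟨hX0, c', v', hv'⟩ := hX
  refine ⟨fun h => hX0 ?_, c * c', fun i x => v i x * v' i x, ?_⟩
  · ext j
    exact (mul_eq_zero.1 (congrFun h j)).resolve_left (hD0 j)
  · rw [hv, hv', smul_outer_mul_smul_outer]

/-- A Hadamard product of rank-one tensors is an elementary tensor. -/
theorem exists_prod_eq_smul_outer {d : ℕ} {n : Fin d → ℕ} {ι : Type*} (s : Finset ι)
    (X : ι → Tensor K n) (hX : ∀ k ∈ s, IsRankOne (X k)) :
    ∃ (c : K) (v : ∀ i, Fin (n i) → K), ∏ k ∈ s, X k = c • outer v := by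
  refine Finset.prod_induction X (fun Y => ∃ (c : K) (v : ∀ i, Fin (n i) → K), Y = c • outer v)
    ?_ ?_ fun k hk => (hX k hk).2
  · rintro _ _ ⟨c, v, rfl⟩ ⟨c', v', rfl⟩
    exact ⟨_, _, smul_outer_mul_smul_outer c c' v v'⟩
  · exact IsRankOneUnit.one.2

/-- A rank-one tensor is recovered from its interpolatory decomposition at a nonzero entry. -/
theorem outer_interpolate {m : ℕ} [NeZero m] {r : Fin m → ℕ} {X : Tensor K r}
    (hX : IsRankOne X) (i : MultiIndex r) (hi : X i ≠ 0) : outer (interpolate i X) = X := by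
  obtain ⟨-, c, v, rfl⟩ := hX
  have hc : c ≠ 0 := fun h => hi (by simp [h])
  have hv : ∀ k, v k (i k) ≠ 0 := fun k h =>
    hi (by rw [Pi.smul_apply, outer, Finset.prod_eq_zero (Finset.mem_univ k) h, smul_zero])
  have hupd : ∀ k l, (c • outer v) (Function.update i k l)
      = (c • outer v) i * (v k l / v k (i k)) := by
    intro k l
    simp only [Pi.smul_apply, smul_eq_mul, outer]
    rw [← Finset.mul_prod_erase _ _ (Finset.mem_univ k),
      ← Finset.mul_prod_erase _ (fun a => v a (i a)) (Finset.mem_univ k),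
      Finset.prod_congr rfl fun a ha => by
        rw [Function.update_of_ne (Finset.ne_of_mem_erase ha)]]
    rw [Function.update_self]
    field_simp [hv k]
  -- Only factor `0` carries the value at `i`, so the product over `k` picks it up exactly once.
  have hint : ∀ k l, interpolate i (c • outer v) k l
      = (if k = 0 then (c • outer v) i else 1) * (v k l / v k (i k)) := by
    intro k l
    unfold interpolate
    rw [hupd]
    split_ifs
    · rfl
    · field_simp
  ext q
  have : outer (interpolate i (c • outer v)) q
      = ∏ k, (if k = 0 then (c • outer v) i else 1) * (v k (q k) / v k (i k)) :=
    Finset.prod_congr rfl fun k _ => hint k (q k)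
  rw [this, Finset.prod_mul_distrib, Finset.prod_ite_eq' Finset.univ (0 : Fin m),
    if_pos (Finset.mem_univ _), Finset.prod_div_distrib]
  have hp : ∏ k, v k (i k) ≠ 0 := Finset.prod_ne_zero_iff.2 fun k _ => hv k
  simp only [Pi.smul_apply, smul_eq_mul, outer]
  field_simp

/-- In a sum of elementary tensors whose number equals the rank of the sum, no term vanishes. -/
theorem ne_zero_of_tensorRank_eq_card {d : ℕ} {n : Fin d → ℕ} {ι : Type*} [Fintype ι]
    {T : Tensor K n} {X : ι → Tensor K n}
    (hX : ∀ q, ∃ (c : K) (v : ∀ i, Fin (n i) → K), X q = c • outer v)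
    (hsum : T = ∑ q, X q) (hrank : tensorRank T = Fintype.card ι) (q : ι) : X q ≠ 0 := by
  classical
  intro hq
  -- Dropping the zero terms gives a decomposition that would be shorter than the rank.
  let e := Fintype.equivFin {q // X q ≠ 0}
  have hmem : IsHitchcock T fun s => X (e.symm s).1 := by
    refine ⟨fun s => ⟨(e.symm s).2, hX _⟩, ?_⟩
    rw [Equiv.sum_comp e.symm fun a : {q // X q ≠ 0} => X a.1, hsum, ← Finset.sum_filter_ne_zero]
    exact Finset.sum_subtype _ (by simp) X
  have hle : tensorRank T ≤ Fintype.card {q // X q ≠ 0} := Nat.sInf_le ⟨_, hmem⟩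
  have hlt : Fintype.card {q // X q ≠ 0} < Fintype.card ι :=
    Fintype.card_subtype_lt (x := q) (by simpa using hq)
  omega

end RankOne

/-! ### Admissible sets and maximal rank-one permutations -/

section Permutations

variable {K : Type*} [Field K]

theorem admissible_trans {R m : ℕ} {r : Fin m → ℕ} (τ : Equiv.Perm (Fin R))
    (ρ : Fin R ≃ MultiIndex r) :
    admissible K (τ.trans ρ) = (fun a => a ∘ τ.symm) ⁻¹' admissible K ρ := rfl

theorem comp_symm_preimage_ssubset_iff {α : Type*} {R : ℕ} (τ : Equiv.Perm (Fin R))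
    {S S' : Set (Fin R → α)} :
    (fun a : Fin R → α => a ∘ τ.symm) ⁻¹' S ⊂ (fun a => a ∘ τ.symm) ⁻¹' S' ↔ S ⊂ S' := by
  have hsurj : Function.Surjective fun a : Fin R → α => a ∘ τ.symm :=
    fun a => ⟨a ∘ τ, by ext; simp⟩
  simp only [Set.ssubset_def, hsurj.preimage_subset_preimage_iff]

/-- Reindexing a vector reindexes its maximal rank-one permutations. -/
theorem IsMaximalRankOnePerm.trans_of_comp {R m : ℕ} {r : Fin m → ℕ} {τ : Equiv.Perm (Fin R)}
    {ρ : Fin R ≃ MultiIndex r} {a : Fin R → K} (h : IsMaximalRankOnePerm ρ (a ∘ τ.symm)) :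
    IsMaximalRankOnePerm (τ.trans ρ) a := by
  refine ⟨h.1, fun m' r' hr' ρ' hlt ha => ?_⟩
  have hρ' : ρ' = τ.trans (τ.symm.trans ρ') := by ext; simp
  rw [hρ'] at hlt ha
  rw [admissible_trans τ (τ.symm.trans ρ'), admissible_trans τ ρ,
    comp_symm_preimage_ssubset_iff] at hlt
  exact h.2 m' r' hr' _ hlt ha

/-- There are finitely many sets of admissible vectors. -/
theorem finite_range_admissible (R : ℕ) :
    {S : Set (Fin R → K) | ∃ (m : ℕ) (r : Fin m → ℕ) (ρ : Fin R ≃ MultiIndex r),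
      (∀ k, 2 ≤ r k) ∧ S = admissible K ρ}.Finite := by
  classical
  -- Factors at least `2` with product `R` force `m < 2 ^ m ≤ R` and `r k ≤ R`, so this finite type
  -- covers all shapes and permutations.
  let F : (Σ m : Fin (R + 1), Σ r : Fin m → Fin (R + 1),
      Fin R ≃ MultiIndex fun k => (r k : ℕ)) → Set (Fin R → K) := fun x => admissible K x.2.2
  refine (Set.finite_range F).subset ?_
  rintro _ ⟨m, r, ρ, hr, rfl⟩
  have hR : ∏ k, r k = R := by simpa using (Fintype.card_congr ρ).symm
  have hm : m < R + 1 := by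
    have : 2 ^ m ≤ R := by
      rw [← hR]
      simpa using Finset.prod_le_prod' (s := Finset.univ) fun k _ => hr k
    have := @Nat.lt_two_pow_self m
    omega
  have hrk : ∀ k, r k < R + 1 := fun k => by
    rw [Nat.lt_succ_iff, ← hR]
    exact Nat.le_of_dvd (Finset.prod_pos fun k _ => by have := hr k; omega)
      (Finset.dvd_prod_of_mem r (Finset.mem_univ k))
  exact ⟨⟨⟨m, hm⟩, fun k => ⟨r k, hrk k⟩, ρ⟩, rfl⟩

/-- Below every rank-one permutation there is a maximal one. -/
theorem exists_isMaximalRankOnePerm {R m : ℕ} {r : Fin m → ℕ} (hr : ∀ k, 2 ≤ r k)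
    {ρ : Fin R ≃ MultiIndex r} {a : Fin R → K} (ha : a ∈ admissible K ρ) :
    ∃ (m' : ℕ) (r' : Fin m' → ℕ) (ρ' : Fin R ≃ MultiIndex r'), (∀ k, 2 ≤ r' k) ∧
      IsMaximalRankOnePerm ρ' a ∧ admissible K ρ' ⊆ admissible K ρ := by
  -- Maximal permutations correspond to inclusion-minimal admissible sets containing `a`; finiteness
  -- provides one below the given set.
  obtain ⟨S, hS, hmin⟩ := ((finite_range_admissible (K := K) R).subset
    (Set.sep_subset _ fun S => a ∈ S)).exists_le_minimal ⟨⟨m, r, ρ, hr, rfl⟩, ha⟩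
  obtain ⟨⟨⟨m', r', ρ', hr', rfl⟩, ha'⟩, hmin⟩ := hmin
  refine ⟨m', r', ρ', hr', ⟨ha', fun m'' r'' hr'' ρ'' hlt ha'' => ?_⟩, hS⟩
  exact hlt.2 (hmin ⟨⟨m'', r'', ρ'', hr'', rfl⟩, ha''⟩ hlt.1)

/-- Rearranging a vector by `ρ` and then applying `ρ.symm.trans ρ'` is rearranging it by `ρ'`. With
the converse below, preserving rank one is the same as inclusion of admissible sets. -/
theorem IsRankOnePreserver.admissible_subset {R m m' : ℕ} {r : Fin m → ℕ} {r' : Fin m' → ℕ}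
    {ρ : Fin R ≃ MultiIndex r} {ρ' : Fin R ≃ MultiIndex r'}
    (h : IsRankOnePreserver K (ρ.symm.trans ρ')) : admissible K ρ ⊆ admissible K ρ' := by
  intro a ha
  have := h _ ha
  simpa [admissible] using this

theorem IsRankOnePreserver.of_admissible_subset {R m m' : ℕ} {r : Fin m → ℕ} {r' : Fin m' → ℕ}
    {ρ : Fin R ≃ MultiIndex r} {ρ' : Fin R ≃ MultiIndex r'}
    (h : admissible K ρ ⊆ admissible K ρ') : IsRankOnePreserver K (ρ.symm.trans ρ') := by
  intro X hX
  have : (fun s => X (ρ s)) ∈ admissible K ρ := by simpa [admissible] using hX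
  simpa [admissible] using h this

/-- The inverse of a rank-one preserver permutation of `[r]` is one of its powers, and therefore
a rank-one preserver too. -/
theorem IsRankOnePreserver.symm {m : ℕ} {r : Fin m → ℕ} {σ : Equiv.Perm (MultiIndex r)}
    (h : IsRankOnePreserver K σ) : IsRankOnePreserver K σ.symm := by
  have hpow : ∀ N : ℕ, IsRankOnePreserver K (σ ^ N : Equiv.Perm (MultiIndex r)) := by
    intro N
    induction N with
    | zero => exact fun X hX => hX
    | succ N ih =>
      intro X hX
      rw [pow_succ']
      exact h _ (ih X hX)
  have hinv : σ.symm = σ ^ (orderOf σ - 1) := by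
    rw [← Equiv.Perm.inv_def, inv_eq_iff_mul_eq_one, ← pow_succ',
      Nat.sub_add_cancel (orderOf_pos σ), pow_orderOf_eq_one]
  rw [hinv]
  exact hpow _

/-- Inclusion between the admissible sets of two permutations of the same shape is equality. -/
theorem admissible_eq_of_subset {R m : ℕ} {r : Fin m → ℕ} {ρ ρ' : Fin R ≃ MultiIndex r}
    (h : admissible K ρ ⊆ admissible K ρ') : admissible K ρ = admissible K ρ' :=
  h.antisymm (IsRankOnePreserver.admissible_subset
    (IsRankOnePreserver.of_admissible_subset h).symm)

/-- If the maximal rank-one permutation is unique and of shape `r`, then all rank-one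
permutations of shape `r` have the same admissible vectors as any maximal one of shape `r`. -/
theorem HasUniqueMaximalRankOnePerm.admissible_eq {R m : ℕ} {r : Fin m → ℕ} (hr : ∀ k, 2 ≤ r k)
    {a : Fin R → K} (h : HasUniqueMaximalRankOnePerm r a) {ρ ρ' : Fin R ≃ MultiIndex r}
    (hρ : a ∈ admissible K ρ) (hρ' : a ∈ admissible K ρ') :
    admissible K ρ = admissible K ρ' := by
  obtain ⟨ρ₀, -, huniq⟩ := h
  -- A maximal `ρ₁` below `ρ` may have another shape, but uniqueness sandwiches its set between
  -- those of `ρ₀` and `ρ`. These two share the shape `r`, so the inclusion is an equality.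
  have key : ∀ ρ : Fin R ≃ MultiIndex r, a ∈ admissible K ρ →
      admissible K ρ₀ = admissible K ρ := by
    intro ρ hρ
    obtain ⟨m', r', ρ₁, hr', hmax, hsub⟩ := exists_isMaximalRankOnePerm hr hρ
    exact admissible_eq_of_subset ((huniq m' r' hr' ρ₁ hmax).admissible_subset.trans hsub)
  exact (key ρ hρ).symm.trans (key ρ' hρ')

end Permutations

/-! ### From HHDs to CPDs and back -/

section Decompositions

variable {K : Type*} [Field K] {d : ℕ} {n : Fin d → ℕ}

theorem exists_perm_of_map_eq {R : ℕ} {α : Type*} {B C : Fin R → α}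
    (h : Finset.univ.val.map B = Finset.univ.val.map C) :
    ∃ τ : Equiv.Perm (Fin R), B = C ∘ τ := by
  classical
  have hcard : ∀ x, Fintype.card {s // B s = x} = Fintype.card {s // C s = x} := fun x => by
    have hx := congrArg (Multiset.count x) h
    simp only [Multiset.count_map, eq_comm (a := x)] at hx
    simp only [Fintype.card_subtype]
    exact hx
  -- Equal multiplicities make the fibres of `B` and `C` over each value equinumerous; the fibrewise
  -- bijections glue to a permutation.
  let e := fun x => Fintype.equivOfCardEq (hcard x)
  refine ⟨(Equiv.sigmaFiberEquiv B).symm.trans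
    ((Equiv.sigmaCongrRight e).trans (Equiv.sigmaFiberEquiv C)), ?_⟩
  ext s
  exact (e (B s) ⟨s, rfl⟩).2.symm

/-- All decompositions of an identifiable tensor are reorderings of each other. -/
theorem IsIdentifiable.exists_perm {s : ℕ} {T : Tensor K n} (h : IsIdentifiable s T)
    {B C : Fin s → Tensor K n} (hB : IsHitchcock T B) (hC : IsHitchcock T C) :
    ∃ τ : Equiv.Perm (Fin s), B = C ∘ τ := by
  obtain ⟨-, M, hM⟩ := h
  have key : ∀ B : Fin s → Tensor K n, IsHitchcock T B → Finset.univ.val.map B = M :=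
    fun B hB => by
      have : Finset.univ.val.map B ∈ decompositions s T := ⟨B, hB, rfl⟩
      rwa [hM] at this
  exact exists_perm_of_map_eq ((key B hB).trans (key C hC).symm)

theorem prod_sum_eq_sum_hht {m : ℕ} {r : Fin m → ℕ} (A : ∀ k, Fin (r k) → Tensor K n) :
    ∏ k, ∑ i, A k i = ∑ q, hht A q := by
  rw [Finset.prod_univ_sum, Fintype.piFinset_univ]
  rfl

theorem hht_apply {m : ℕ} {r : Fin m → ℕ} (A : ∀ k, Fin (r k) → Tensor K n) (q : MultiIndex r)
    (j : MultiIndex n) : hht A q j = outer (fun k l => A k l j) q := by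
  simp [hht, outer]

theorem sum_stack {m R : ℕ} {r : Fin m → ℕ} (ρ : Fin R ≃ MultiIndex r)
    (B : Fin R → Tensor K n) : ∑ q, stack ρ B q = ∑ s, B s :=
  Equiv.sum_comp ρ.symm B

/-- If the rank of `T` is the number of terms in the expansion of an HHD, then the expansion
is a reordering of the terms of every CPD of the identifiable tensor `T`. -/
theorem IsHHD.exists_stack_eq {m : ℕ} {r : Fin m → ℕ} {T : Tensor K n}
    {A : ∀ k, Fin (r k) → Tensor K n} (hA : IsHHD T A) (hT : IsIdentifiable (∏ k, r k) T)
    {B : Fin (∏ k, r k) → Tensor K n} (hB : IsHitchcock T B) :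
    ∃ ρ : Fin (∏ k, r k) ≃ MultiIndex r, stack ρ B = hht A := by
  have hcard : Fintype.card (MultiIndex r) = ∏ k, r k := by simp
  have hsum : T = ∑ q, hht A q := hA.2.trans (prod_sum_eq_sum_hht A)
  have hel : ∀ q, ∃ (c : K) (v : ∀ i, Fin (n i) → K), hht A q = c • outer v :=
    fun q => exists_prod_eq_smul_outer _ _ fun k _ => hA.1 k (q k)
  let e : Fin (∏ k, r k) ≃ MultiIndex r := (Fintype.equivFinOfCardEq hcard).symm
  have hH : IsHitchcock T (hht A ∘ e) :=
    ⟨fun s => ⟨ne_zero_of_tensorRank_eq_card hel hsum (hT.1.trans hcard.symm) _, hel _⟩,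
      hsum.trans (Equiv.sum_comp e (hht A)).symm⟩
  obtain ⟨τ, rfl⟩ := hT.exists_perm hB hH
  exact ⟨τ.trans e, by ext; simp [stack]⟩

/-- Each slice at fixed `j` is rank one with nonzero entry at `i`, so its interpolatory
decomposition multiplies back to it. -/
theorem hht_decouple {m R : ℕ} [NeZero m] {r : Fin m → ℕ} {ρ : Fin R ≃ MultiIndex r}
    {B : Fin R → Tensor K n} {i : MultiIndex r} (hi : ∀ j, stack ρ B i j ≠ 0)
    (hrank : ∀ j, entryVector B j ∈ admissible K ρ) : hht (decouple ρ B i) = stack ρ B := by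
  ext q j
  rw [hht_apply]
  exact congrFun (outer_interpolate (hrank j) i (hi j)) q

/-- The output is built entry by entry in `j`, yet as a tensor in `j` it is a single term of `B`, or
such a term divided by the base term, whose inverse lies in `S^*`. -/
theorem isRankOne_decouple {m R : ℕ} [NeZero m] {r : Fin m → ℕ} {ρ : Fin R ≃ MultiIndex r}
    {B : Fin R → Tensor K n} (hB : ∀ s, IsRankOne (B s)) {i : MultiIndex r}
    (hi : IsRankOneUnit (stack ρ B i)) (k : Fin m) (l : Fin (r k)) :
    IsRankOne (decouple ρ B i k l) := by
  by_cases hk : k = 0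
  · have : decouple ρ B i k l = stack ρ B (Function.update i k l) := by
      ext j
      simp [decouple, interpolate, hk]
    rw [this]
    exact hB _
  · have : decouple ρ B i k l = (stack ρ B i)⁻¹ * stack ρ B (Function.update i k l) := by
      ext j
      simp [decouple, interpolate, hk, div_eq_inv_mul]
    rw [this]
    exact hi.inv.mul_isRankOne (hB _)

end Decompositions

/-! ### Correctness of the algorithm -/

theorem mainTheorem8 {K : Type*} [Field K] [CharZero K] {d m : ℕ} [NeZero m]
    (n : Fin d → ℕ) (r : Fin m → ℕ) (hr : ∀ k, 2 ≤ r k) (T : Tensor K n)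
    (hT : IsHHDIdentifiable r T)
    (hTR : IsIdentifiable (∏ k, r k) T)
    (C : Fin (∏ k, r k) → Tensor K n) (hC : IsCPD T C)
    (hunit : ∃ s, IsRankOneUnit (C s))
    (p : MultiIndex n)
    (hinj : Function.Injective (entryVector C p))
    (huniq : HasUniqueMaximalRankOnePerm r (entryVector C p)) :
    -- step 1: `B` is the computed CPD
    ∀ B : Fin (∏ k, r k) → Tensor K n, IsCPD T B →
      -- step 2: `ρ` is the computed rank-1 permutation
      (∃ ρ : Fin (∏ k, r k) ≃ MultiIndex r, IsMaximalRankOnePerm ρ (entryVector B p)) ∧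
      ∀ ρ : Fin (∏ k, r k) ≃ MultiIndex r, IsMaximalRankOnePerm ρ (entryVector B p) →
        -- steps 3 and 4: stack the terms, and extract at a base index `i`
        (∃ i : MultiIndex r, IsRankOneUnit (stack ρ B i)) ∧
        ∀ i : MultiIndex r, IsRankOneUnit (stack ρ B i) →
          hht (decouple ρ B i) = stack ρ B ∧
          ∃ h : IsHHD T (decouple ρ B i),
            ∀ E : EssentialHHD r T, E = EssentialHHD.mk (decouple ρ B i) h := by
  intro B hB
  obtain ⟨τ, rfl⟩ := hTR.exists_perm hB.2 hC.2
  obtain ⟨E₀, hE₀⟩ := hT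
  obtain ⟨⟨A, hA⟩, -⟩ := Quotient.exists_rep E₀
  obtain ⟨ρ₁, hρ₁⟩ := hA.exists_stack_eq hTR hC.2
  -- The nonzero entry is needed because rank one excludes the zero tensor.
  have hadm : ∀ j, (∃ s, C s j ≠ 0) → entryVector C j ∈ admissible K ρ₁ := by
    rintro j ⟨s, hs⟩
    refine ⟨fun h => hs ?_, 1, fun k l => A k l j, ?_⟩
    · simpa [entryVector] using congrFun h (ρ₁ s)
    · rw [one_smul]
      ext q
      rw [← hht_apply, ← hρ₁]
      rfl
  obtain ⟨s₀, hs₀⟩ := hunit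
  refine ⟨?_, fun ρ hρ => ⟨⟨ρ (τ.symm s₀), by simpa [stack] using hs₀⟩, fun i hi => ?_⟩⟩
  · obtain ⟨ρ, hρ, -⟩ := huniq
    refine ⟨τ.trans ρ, IsMaximalRankOnePerm.trans_of_comp ?_⟩
    convert hρ using 1
    ext s
    simp [entryVector]
  -- Undoes the reordering `τ` of the computed CPD, so that uniqueness, assumed for `C`, applies.
  have hρC : IsMaximalRankOnePerm (τ.symm.trans ρ) (entryVector C p) :=
    IsMaximalRankOnePerm.trans_of_comp hρ
  -- `ρ₁` is not known to be maximal, only admissible at `p`. The resulting equality of sets no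
  -- longer mentions `p`, so it transfers admissibility to every `j`.
  have heq := huniq.admissible_eq hr (hadm p ⟨s₀, hs₀.1 p⟩) hρC.1
  have hrank : ∀ j, entryVector (C ∘ τ) j ∈ admissible K ρ := fun j => by
    have := hadm j ⟨s₀, hs₀.1 j⟩
    rw [heq] at this
    exact this
  have hht_eq := hht_decouple hi.1 hrank
  have hHHD : IsHHD T (decouple ρ (C ∘ τ) i) := by
    refine ⟨isRankOne_decouple hB.2.1 hi, ?_⟩
    rw [prod_sum_eq_sum_hht, hht_eq, sum_stack]
    exact hB.2.2
  exact ⟨hht_eq, hHHD, fun E => (hE₀ E).trans (hE₀ _).symm⟩
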